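/- Fix constants $0<r_0<R<p$, $\alpha>1$, $\beta>0$ and $P_{\rm con}>0$. A dense network with $B\ge 1$ transmitters, $K\ge 1$ users and $N\ge 1$ resource blocks is given as follows. Transmitter $i$ is located at a deterministic, arbitrary point $(a_i,b_i)$ of the disc of radius $p-R$ about the origin; the users' locations $(x_k,y_k)$ are i.i.d. uniform in the concentric disc of radius $p$; the complex fading factors $\nu_{i,k,n}$ are i.i.d. over all $(i,k,n)$ and independent of the users' locations. Put $R_{i,k}=\max\{r_0,\sqrt{(x_k-a_i)^2+(y_k-b_i)^2}\}$ and $\gamma_{i,k,n}=|\beta R_{i,k}^{-\alpha}\nu_{i,k,n}|^2$. The expected achievable sum-rate is $$\mathcal C^*=\mathbb E\Big\{\max_{u,\,P}\ \sum_{i=1}^B\sum_{n=1}^N\log\Big(1+\frac{P_{i,n}\gamma_{i,u_{i,n},n}}{1+\sum_{j\ne i}P_{j,n}\gamma_{j,u_{i,n},n}}\Big)\Big\},$$ where the maximum is over all user allocations $u_{i,n}\in\{1,\dots,K\}$ and all powers $P_{i,n}\ge 0$ with $\sum_n P_{i,n}\le P_{\rm con}$ for every $i$. For each of the following laws of $|\nu_{i,k,n}|$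 there are constants $c_1,c_2>0$ and $K_0$, depending only on $p,R,r_0,\alpha,\beta,P_{\rm con}$ and the law of $|\nu_{i,k,n}|$ (not on $B$, $N$ or the transmitter locations), such that for all $K\ge K_0$, all $B,N\ge 1$ and all transmitter locations the expectation $\mathcal C^*$ is finite and $$c_2\,\min\{B,N\}\,g(K)\ \le\ \mathcal C^*\ \le\ c_1\,BN\,g(K),$$ that is, $\mathcal C^*=O(BN\,g(K))$ and $\mathcal C^*=\Omega(\min\{B,N\}\,g(K))$, where: 1. Nakagami-$(m,w)$, $m,w>0$ (density $\frac{2m^m}{\Gamma(m)w^m}x^{2m-1}e^{-mx^2/w}$ for $x>0$): $g(K)=\log\log K$. 2. Weibull$(\lambda,t)$, $\lambda,t>0$ (density $\frac{t}{\lambda}(\frac{x}{\lambda})^{t-1}e^{-(x/\lambda)^t}$ for $x>0$): $g(K)=\log\big((\log K)^{2/t}\big)$. 3. LogNormal$(a,\omega)$, $a\in\mathbb R$, $\omega>0$ ($\log|\nu_{i,k,n}|$ is Gaussian with mean $a$ and variance $\omega$): $g(K)=\sqrt{\log K}$. -/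

import Mathlib

universe u

noncomputable section

namespace DenseNetwork

open MeasureTheory ProbabilityTheory
open scoped NNReal ENNReal

/-- The plane with its Euclidean distance and Lebesgue measure. -/
abbrev Plane := EuclideanSpace ℝ (Fin 2)

/-- The constants of a dense network: users lie in the disc of radius `p`, transmitters in the
concentric disc of radius `p - R`, `r₀` is the truncation distance of the path loss
`β * dist ^ (-α)`, and `Pcon` is the power budget of each transmitter. -/
structure Params where
  p : ℝ
  R : ℝ
  r₀ : ℝ
  α : ℝ
  β : ℝ
  Pcon : ℝ
  r₀_pos : 0 < r₀
  r₀_lt_R : r₀ < R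
  R_lt_p : R < p
  one_lt_α : 1 < α
  β_pos : 0 < β
  Pcon_pos : 0 < Pcon

/-! ### Fading distributions -/

/-- Density of the Nakagami distribution with shape `m` and spread `w`. -/
def nakagamiPDF (m w x : ℝ) : ℝ :=
  if 0 < x then
    2 * m ^ m / (Real.Gamma m * w ^ m) * x ^ (2 * m - 1) * Real.exp (-(m / w) * x ^ 2)
  else 0

/-- The Nakagami-`(m, w)` distribution. -/
def nakagami (m w : ℝ) : Measure ℝ :=
  volume.withDensity fun x => ENNReal.ofReal (nakagamiPDF m w x)

/-- Density of the Weibull distribution with scale `l` and shape `t`. -/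
def weibullPDF (l t x : ℝ) : ℝ :=
  if 0 < x then t / l * (x / l) ^ (t - 1) * Real.exp (-(x / l) ^ t) else 0

/-- The Weibull-`(l, t)` distribution. -/
def weibull (l t : ℝ) : Measure ℝ :=
  volume.withDensity fun x => ENNReal.ofReal (weibullPDF l t x)

/-- The LogNormal-`(a, v)` distribution: the law of `exp G`, where `G` is Gaussian with mean `a`
and variance `v`. -/
def logNormal (a : ℝ) (v : ℝ≥0) : Measure ℝ :=
  (gaussianReal a v).map Real.exp

/-! ### Channel and sum-rate -/

/-- Truncated distance between a transmitter at `a` and a user at `x`. -/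
def truncDist (S : Params) (a x : Plane) : ℝ := max S.r₀ (dist x a)

/-- Complex channel gain between a transmitter at `a` and a user at `x` with fading factor `z`. -/
def channelGain (S : Params) (a x : Plane) (z : ℂ) : ℂ :=
  ((S.β * truncDist S a x ^ (-S.α) : ℝ) : ℂ) * z

/-- Channel signal-to-noise ratio (unit noise variance). -/
def snr (S : Params) (a x : Plane) (z : ℂ) : ℝ := ‖channelGain S a x z‖ ^ 2

/-- Feasible power allocations of `B` transmitters over `N` resource blocks. -/
def feasiblePowers (B N : ℕ) (Pcon : ℝ) : Set (Fin B → Fin N → ℝ) :=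
  {P | (∀ i n, 0 ≤ P i n) ∧ ∀ i, ∑ n, P i n ≤ Pcon}

/-- Sum-rate for the SNRs `γ i k n` (transmitter, user, resource block) when transmitter `i` serves
user `U i n` with power `P i n` on block `n`, interference being treated as noise. -/
def sumRate {B K N : ℕ} (γ : Fin B → Fin K → Fin N → ℝ) (U : Fin B → Fin N → Fin K)
    (P : Fin B → Fin N → ℝ) : ℝ :=
  ∑ i, ∑ n, Real.log
    (1 + P i n * γ i (U i n) n / (1 + ∑ j ∈ Finset.univ.erase i, P j n * γ j (U i n) n))

/-- Maximum of the sum-rate over all user allocations and all feasible power allocations. -/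
def maxSumRate {B K N : ℕ} (Pcon : ℝ) (γ : Fin B → Fin K → Fin N → ℝ) : ℝ :=
  ⨆ q : (Fin B → Fin N → Fin K) × feasiblePowers B N Pcon, sumRate γ q.1 q.2

/-- The maximum sum-rate as a random variable, for transmitters at `tx i`, users at `x k`, and
fading factors `ν i k n`. -/
def rate (S : Params) {Ω : Type u} {B K N : ℕ} (tx : Fin B → Plane) (x : Fin K → Ω → Plane)
    (ν : Fin B → Fin K → Fin N → Ω → ℂ) (ω : Ω) : ℝ :=
  maxSumRate S.Pcon fun i k n => snr S (tx i) (x k ω) (ν i k n ω)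

/-- The probabilistic model: transmitters in the disc of radius `p - R`; users i.i.d. uniform in the
disc of radius `p`; fading factors i.i.d. with modulus of law `F`; users and fading independent. -/
structure IsModel (S : Params) (F : Measure ℝ) {Ω : Type u} [MeasurableSpace Ω] (μ : Measure Ω)
    {B K N : ℕ} (tx : Fin B → Plane) (x : Fin K → Ω → Plane)
    (ν : Fin B → Fin K → Fin N → Ω → ℂ) : Prop where
  tx_mem : ∀ i, tx i ∈ Metric.closedBall (0 : Plane) (S.p - S.R)
  measurable_user : ∀ k, Measurable (x k)
  uniform_user : ∀ k, pdf.IsUniform (x k) (Metric.closedBall (0 : Plane) S.p) μ volume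
  indep_user : iIndepFun x μ
  measurable_fading : ∀ i k n, Measurable (ν i k n)
  identDistrib_fading : ∀ i k n i' k' n', IdentDistrib (ν i k n) (ν i' k' n') μ μ
  law_fading : ∀ i k n, μ.map (fun ω => ‖ν i k n ω‖) = F
  indep_fading :
    iIndepFun (fun (q : Fin B × Fin K × Fin N) (ω : Ω) => ν q.1 q.2.1 q.2.2 ω) μ
  indep_user_fading :
    IndepFun (fun ω k => x k ω) (fun ω (q : Fin B × Fin K × Fin N) => ν q.1 q.2.1 q.2.2 ω) μ

/-- The expected achievable sum-rate is `O(B N g(K))` and `Ω(min{B, N} g(K))` for large `K`. The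
constants and the threshold depend only on the network constants and the fading law; they are
uniform in `B`, `N`, the transmitter locations and the realization of the model. -/
def ScalingLaw (S : Params) (F : Measure ℝ) (g : ℕ → ℝ) : Prop :=
  ∃ c₁ : ℝ, 0 < c₁ ∧ ∃ c₂ : ℝ, 0 < c₂ ∧ ∃ K₀ : ℕ, ∀ K B N : ℕ, K₀ ≤ K → 1 ≤ B → 1 ≤ N →
    ∀ (Ω : Type u) [MeasurableSpace Ω] (μ : Measure Ω) [IsProbabilityMeasure μ]
      (tx : Fin B → Plane) (x : Fin K → Ω → Plane) (ν : Fin B → Fin K → Fin N → Ω → ℂ),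
      IsModel S F μ tx x ν →
        Integrable (rate S tx x ν) μ ∧
        ∫ ω, rate S tx x ν ω ∂μ ≤ c₁ * ((B : ℝ) * (N : ℝ) * g K) ∧
        c₂ * (min (B : ℝ) (N : ℝ) * g K) ≤ ∫ ω, rate S tx x ν ω ∂μ

end DenseNetwork

end

/-! Upper bound: discarding interference and giving every link full power at distance `S.r₀` bounds
the rate by the sum over `(i, n)` of the largest of `K` copies of log(1 + c|ν|²). If exp(q(|ν|)) has
mean M, the expected maximum of the q(|ν|) is at most log K + M (`le_log_card_add_average_exp`), so
a bound log(1 + cy²) ≤ a + b q(y), with a and b tuned to K, bounds the expected rate by BN(a + b(log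
K + M)).

Lower bound: transmitter l puts all its power on block l, for l < min(B, N), so these links do not
interfere. If |ν| ≥ s has probability at least 1/K, then with probability at least 1/2 some user of
link l has fading at least s (`one_half_le_measureReal_exists_le`), and all distances are at most
2p.

`scalingLaw_of_bounds` combines the two. Nakagami and Weibull are generalized gamma laws with decay
exp(-by^t): q is a multiple of y^t and s = (δ log K)^(1/t). For the log-normal law q is a multiple
of (log y)² and s = exp(√(δ log K)). -/

namespace DenseNetwork

open MeasureTheory ProbabilityTheory Filter
open scoped NNReal ENNReal Topology

/-! ### Deterministic bounds for the maximum sum-rate -/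

section Deterministic

variable {B K N : ℕ} {Pcon : ℝ} {γ : Fin B → Fin K → Fin N → ℝ}

lemma power_le_of_feasible {P : Fin B → Fin N → ℝ} (hP : P ∈ feasiblePowers B N Pcon)
    (i : Fin B) (n : Fin N) : P i n ≤ Pcon :=
  (Finset.single_le_sum (fun n _ => hP.1 i n) (Finset.mem_univ n)).trans (hP.2 i)

lemma zero_mem_feasiblePowers (hPcon : 0 ≤ Pcon) : 0 ∈ feasiblePowers B N Pcon :=
  ⟨fun _ _ => le_rfl, fun _ => by simpa using hPcon⟩

lemma one_le_interference (hγ : ∀ i k n, 0 ≤ γ i k n) {P : Fin B → Fin N → ℝ}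
    (hP : P ∈ feasiblePowers B N Pcon) (i : Fin B) (k : Fin K) (n : Fin N) :
    1 ≤ 1 + ∑ j ∈ Finset.univ.erase i, P j n * γ j k n :=
  le_add_of_nonneg_right (Finset.sum_nonneg fun j _ => mul_nonneg (hP.1 j n) (hγ j k n))

lemma sinr_nonneg (hγ : ∀ i k n, 0 ≤ γ i k n) {P : Fin B → Fin N → ℝ}
    (hP : P ∈ feasiblePowers B N Pcon) (i : Fin B) (k : Fin K) (n : Fin N) :
    0 ≤ P i n * γ i k n / (1 + ∑ j ∈ Finset.univ.erase i, P j n * γ j k n) :=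
  div_nonneg (mul_nonneg (hP.1 i n) (hγ i k n))
    (zero_le_one.trans (one_le_interference hγ hP i k n))

lemma sumRate_le (hγ : ∀ i k n, 0 ≤ γ i k n) {P : Fin B → Fin N → ℝ}
    (hP : P ∈ feasiblePowers B N Pcon) (U : Fin B → Fin N → Fin K) {D : Fin B → Fin N → ℝ}
    (hD : ∀ i k n, Real.log (1 + Pcon * γ i k n) ≤ D i n) :
    sumRate γ U P ≤ ∑ i, ∑ n, D i n := by
  refine Finset.sum_le_sum fun i _ => Finset.sum_le_sum fun n _ => le_trans ?_ (hD i (U i n) n)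
  have h0 := sinr_nonneg hγ hP i (U i n) n
  refine Real.log_le_log (by linarith) (by
    gcongr
    refine (div_le_self (mul_nonneg (hP.1 i n) (hγ _ _ _)) (one_le_interference hγ hP _ _ _)).trans ?_
    exact mul_le_mul_of_nonneg_right (power_le_of_feasible hP i n) (hγ _ _ _))

lemma bddAbove_range_sumRate (hPcon : 0 ≤ Pcon) (hγ : ∀ i k n, 0 ≤ γ i k n) :
    BddAbove (Set.range fun q : (Fin B → Fin N → Fin K) × feasiblePowers B N Pcon =>
      sumRate γ q.1 q.2) := by
  refine ⟨∑ i, ∑ n, ∑ k, Real.log (1 + Pcon * γ i k n), ?_⟩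
  rintro _ ⟨q, rfl⟩
  refine sumRate_le hγ q.2.2 q.1 fun i k n => ?_
  exact Finset.single_le_sum (f := fun k => Real.log (1 + Pcon * γ i k n))
    (fun k _ => Real.log_nonneg (le_add_of_nonneg_right (mul_nonneg hPcon (hγ i k n))))
    (Finset.mem_univ k)

lemma maxSumRate_le [NeZero K] (hPcon : 0 ≤ Pcon) (hγ : ∀ i k n, 0 ≤ γ i k n)
    {D : Fin B → Fin N → ℝ} (hD : ∀ i k n, Real.log (1 + Pcon * γ i k n) ≤ D i n) :
    maxSumRate Pcon γ ≤ ∑ i, ∑ n, D i n := by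
  have : Nonempty (feasiblePowers B N Pcon) := ⟨⟨0, zero_mem_feasiblePowers hPcon⟩⟩
  exact ciSup_le fun q => sumRate_le hγ q.2.2 q.1 hD

lemma maxSumRate_nonneg (hγ : ∀ i k n, 0 ≤ γ i k n) : 0 ≤ maxSumRate Pcon γ :=
  Real.iSup_nonneg fun q => Finset.sum_nonneg fun i _ => Finset.sum_nonneg fun n _ =>
    Real.log_nonneg (le_add_of_nonneg_right (sinr_nonneg hγ q.2.2 i (q.1 i n) n))

/-- Each transmitter concentrates its power on the resource block with its own index. -/
noncomputable def diagonalPower (B N : ℕ) (Pcon : ℝ) (i : Fin B) (n : Fin N) : ℝ :=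
  if i.val = n.val then Pcon else 0

lemma diagonalPower_mem (hPcon : 0 ≤ Pcon) :
    diagonalPower B N Pcon ∈ feasiblePowers B N Pcon := by
  refine ⟨fun i n => by unfold diagonalPower; split_ifs <;> simp [hPcon], fun i => ?_⟩
  unfold diagonalPower
  by_cases hi : i.val < N
  · rw [Finset.sum_eq_single (⟨i.val, hi⟩ : Fin N)]
    · simp
    · intro n _ hn
      rw [if_neg]
      exact fun h => hn (Fin.ext h.symm)
    · simp
  · rw [Finset.sum_eq_zero]
    · exact hPcon
    · intro n _
      rw [if_neg]
      have := n.isLt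
      omega

lemma sum_le_maxSumRate [NeZero K] (hPcon : 0 ≤ Pcon) (hγ : ∀ i k n, 0 ≤ γ i k n)
    {d : Fin (min B N) → ℝ}
    (hd : ∀ l, ∃ k, d l ≤ Real.log
      (1 + Pcon * γ (l.castLE (min_le_left B N)) k (l.castLE (min_le_right B N)))) :
    ∑ l, d l ≤ maxSumRate Pcon γ := by
  choose κ hκ using hd
  -- The default user `0` is harmless: terms off the diagonal are only used through their
  -- nonnegativity.
  let U : Fin B → Fin N → Fin K := fun i _ =>
    if h : i.val < min B N then κ ⟨i.val, h⟩ else 0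
  refine le_trans ?_ (le_ciSup (bddAbove_range_sumRate hPcon hγ)
    (U, ⟨diagonalPower B N Pcon, diagonalPower_mem hPcon⟩))
  have hnn := fun i n => Real.log_nonneg (le_add_of_nonneg_right
    (sinr_nonneg hγ (diagonalPower_mem (B := B) (N := N) hPcon) i (U i n) n))
  simp only [sumRate]
  rw [← Fintype.sum_prod_type']
  let e : Fin (min B N) ↪ Fin B × Fin N :=
    ⟨fun l => (l.castLE (min_le_left B N), l.castLE (min_le_right B N)), fun l l' h => by
      simpa using congrArg (fun z => z.1.val) h |> fun h => Fin.ext h⟩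
  refine le_trans ?_ (Finset.sum_le_univ_sum_of_nonneg (s := Finset.univ.map e)
    fun z => hnn z.1 z.2)
  rw [Finset.sum_map]
  refine Finset.sum_le_sum fun l _ => (hκ l).trans_eq ?_
  have hU : U (l.castLE (min_le_left B N)) (l.castLE (min_le_right B N)) = κ l :=
    dif_pos l.isLt
  have hI : ∑ j ∈ Finset.univ.erase (l.castLE (min_le_left B N)),
      diagonalPower B N Pcon j (l.castLE (min_le_right B N)) *
        γ j (κ l) (l.castLE (min_le_right B N)) = 0 := by
    refine Finset.sum_eq_zero fun j hj => ?_
    rw [diagonalPower, if_neg, zero_mul]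
    exact fun h => (Finset.mem_erase.1 hj).1 (Fin.ext h)
  have he : e l = (l.castLE (min_le_left B N), l.castLE (min_le_right B N)) := rfl
  rw [he]
  dsimp only
  rw [hU, hI, add_zero, div_one, diagonalPower, if_pos (by rfl)]

end Deterministic

/-- The supremum is over an uncountable set of powers, but a supremum of continuous functions is
lower semicontinuous. The absolute values keep every denominator at least 1, hence continuity on the
whole space. -/
lemma measurable_maxSumRate {B K N : ℕ} {Pcon : ℝ} (hPcon : 0 ≤ Pcon) :
    Measurable fun γ : Fin B → Fin K → Fin N → ℝ => maxSumRate Pcon fun i k n => |γ i k n| := by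
  refine LowerSemicontinuous.measurable (lowerSemicontinuous_ciSup
    (fun γ => bddAbove_range_sumRate hPcon fun i k n => abs_nonneg _) fun q => ?_)
  refine Continuous.lowerSemicontinuous ?_
  unfold sumRate
  refine continuous_finsetSum _ fun i _ => continuous_finsetSum _ fun n _ => ?_
  refine Continuous.log ?_ fun γ => ?_
  · refine continuous_const.add (Continuous.div (by fun_prop) (by fun_prop) fun γ => ?_)
    exact (zero_lt_one.trans_le (one_le_interference (γ := fun i k n => |γ i k n|)
      (fun _ _ _ => abs_nonneg _) q.2.2 _ _ _)).ne'
  · have := sinr_nonneg (γ := fun i k n => |γ i k n|) (fun _ _ _ => abs_nonneg _) q.2.2 i (q.1 i n) n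
    positivity

/-! ### Path loss -/

lemma truncDist_pos (S : Params) (a x : Plane) : 0 < truncDist S a x :=
  S.r₀_pos.trans_le (le_max_left _ _)

lemma snr_eq (S : Params) (a x : Plane) (z : ℂ) :
    snr S a x z = S.β ^ 2 * (truncDist S a x ^ (-S.α)) ^ 2 * ‖z‖ ^ 2 := by
  rw [snr, channelGain, norm_mul, Complex.norm_real, Real.norm_eq_abs, mul_pow, sq_abs, mul_pow]

lemma snr_nonneg (S : Params) (a x : Plane) (z : ℂ) : 0 ≤ snr S a x z := sq_nonneg _

/-- The SNR factor of a link at truncated distance `r` and full power. -/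
noncomputable def linkFactor (S : Params) (r : ℝ) : ℝ := S.Pcon * (S.β ^ 2 * (r ^ (-S.α)) ^ 2)

lemma linkFactor_pos (S : Params) {r : ℝ} (hr : 0 < r) : 0 < linkFactor S r := by
  have := S.Pcon_pos
  have := S.β_pos
  unfold linkFactor
  positivity

lemma Pcon_mul_snr (S : Params) (a x : Plane) (z : ℂ) :
    S.Pcon * snr S a x z = linkFactor S (truncDist S a x) * ‖z‖ ^ 2 := by
  rw [snr_eq, linkFactor]; ring

lemma linkFactor_anti (S : Params) {r r' : ℝ} (hr : 0 < r) (h : r ≤ r') :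
    linkFactor S r' ≤ linkFactor S r := by
  have := S.Pcon_pos
  have := S.one_lt_α
  have h1 : r' ^ (-S.α) ≤ r ^ (-S.α) := Real.rpow_le_rpow_of_nonpos hr h (by linarith)
  have h2 : 0 ≤ r' ^ (-S.α) := Real.rpow_nonneg (hr.le.trans h) _
  unfold linkFactor
  gcongr

lemma log_one_add_snr_le (S : Params) (a x : Plane) (z : ℂ) :
    Real.log (1 + S.Pcon * snr S a x z) ≤ Real.log (1 + linkFactor S S.r₀ * ‖z‖ ^ 2) := by
  have h := linkFactor_pos S (truncDist_pos S a x)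
  rw [Pcon_mul_snr]
  refine Real.log_le_log (by positivity) ?_
  gcongr
  exact linkFactor_anti S S.r₀_pos (le_max_left _ _)

lemma le_log_one_add_snr (S : Params) {a x : Plane} (z : ℂ)
    (ha : a ∈ Metric.closedBall (0 : Plane) (S.p - S.R))
    (hx : x ∈ Metric.closedBall (0 : Plane) S.p) {s : ℝ} (hs : 0 ≤ s) (hz : s ≤ ‖z‖) :
    Real.log (1 + linkFactor S (2 * S.p) * s ^ 2) ≤ Real.log (1 + S.Pcon * snr S a x z) := by
  have := S.r₀_pos
  have := S.r₀_lt_R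
  have := S.R_lt_p
  have h := linkFactor_pos S (r := 2 * S.p) (by linarith)
  rw [Pcon_mul_snr]
  refine Real.log_le_log (by positivity) ?_
  have h0 := linkFactor_pos S (truncDist_pos S a x)
  gcongr
  refine linkFactor_anti S (truncDist_pos S a x)
    (max_le (by linarith : S.r₀ ≤ 2 * S.p) ?_)
  have h1 := dist_triangle x 0 a
  rw [Metric.mem_closedBall] at ha hx
  rw [dist_comm 0 a] at h1
  linarith

/-! ### Bounds for the expected rate -/

section Expectation

variable {S : Params} {F : Measure ℝ} {Ω : Type u} [MeasurableSpace Ω] {μ : Measure Ω}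
  {B K N : ℕ} {tx : Fin B → Plane} {x : Fin K → Ω → Plane} {ν : Fin B → Fin K → Fin N → Ω → ℂ}

lemma IsModel.measurable_rate (h : IsModel S F μ tx x ν) : Measurable (rate S tx x ν) := by
  have hm : Measurable fun ω => fun i k n => snr S (tx i) (x k ω) (ν i k n ω) := by
    refine measurable_pi_lambda _ fun i => measurable_pi_lambda _ fun k =>
      measurable_pi_lambda _ fun n => ?_
    have h1 := h.measurable_user k
    have h2 := h.measurable_fading i k n
    simp only [snr_eq, truncDist]
    fun_prop
  have := (measurable_maxSumRate (B := B) (K := K) (N := N) S.Pcon_pos.le).comp hm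
  simp only [Function.comp_def, abs_of_nonneg (snr_nonneg _ _ _ _)] at this
  exact this

/-- This is `1 + u ≤ exp u` at `u = y k - log card`. The right side does not depend on `k` and is an
average, so bounding the expected maximum needs no independence. -/
lemma le_log_card_add_average_exp {ι : Type*} [Fintype ι] (y : ι → ℝ) (k : ι) :
    y k ≤ Real.log (Fintype.card ι) + (Fintype.card ι : ℝ)⁻¹ * ∑ j, Real.exp (y j) := by
  have : Nonempty ι := ⟨k⟩
  have hc : (0 : ℝ) < Fintype.card ι := by exact_mod_cast Fintype.card_pos
  have h1 := Real.add_one_le_exp (y k - Real.log (Fintype.card ι))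
  rw [Real.exp_sub, Real.exp_log hc, div_eq_inv_mul] at h1
  have h2 : Real.exp (y k) ≤ ∑ j, Real.exp (y j) :=
    Finset.single_le_sum (f := fun j => Real.exp (y j)) (fun j _ => (Real.exp_pos _).le)
      (Finset.mem_univ k)
  have h3 := mul_le_mul_of_nonneg_left h2 (inv_pos.2 hc).le
  linarith

lemma IsModel.integrable_rate_and_integral_le [IsProbabilityMeasure μ] [NeZero K]
    (h : IsModel S F μ tx x ν) {q : ℝ → ℝ} (hq : Integrable (fun y => Real.exp (q y)) F)
    {a b : ℝ} (hb : 0 ≤ b)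
    (hab : ∀ y, 0 ≤ y → Real.log (1 + linkFactor S S.r₀ * y ^ 2) ≤ a + b * q y) :
    Integrable (rate S tx x ν) μ ∧ ∫ ω, rate S tx x ν ω ∂μ ≤
      B * N * (a + b * (Real.log K + ∫ y, Real.exp (q y) ∂F)) := by
  have hint : ∀ i k n, Integrable (fun ω => Real.exp (q ‖ν i k n ω‖)) μ := fun i k n => by
    have hm := (h.measurable_fading i k n).norm.aemeasurable (μ := μ)
    rw [← h.law_fading i k n] at hq
    exact (integrable_map_measure hq.aestronglyMeasurable hm).1 hq
  have hval : ∀ i k n, ∫ ω, Real.exp (q ‖ν i k n ω‖) ∂μ = ∫ y, Real.exp (q y) ∂F := fun i k n => by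
    have hm := (h.measurable_fading i k n).norm.aemeasurable (μ := μ)
    have hq' := hq.aestronglyMeasurable
    rw [← h.law_fading i k n] at hq' ⊢
    exact (integral_map hm hq').symm
  set D : Fin B → Fin N → Ω → ℝ := fun i n ω =>
    a + b * (Real.log K + (K : ℝ)⁻¹ * ∑ k, Real.exp (q ‖ν i k n ω‖)) with hDdef
  have hS : ∀ i n, Integrable (fun ω => (K : ℝ)⁻¹ * ∑ k, Real.exp (q ‖ν i k n ω‖)) μ := fun i n =>
    (integrable_finsetSum _ fun k _ => hint i k n).const_mul _
  have hD : ∀ i n, Integrable (D i n) μ := fun i n =>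
    (integrable_const a).add (((integrable_const _).add (hS i n)).const_mul b)
  have hDval : ∀ i n, ∫ ω, D i n ω ∂μ = a + b * (Real.log K + ∫ y, Real.exp (q y) ∂F) := by
    intro i n
    have hK : (K : ℝ) ≠ 0 := by exact_mod_cast NeZero.ne K
    have hL : Integrable (fun ω => Real.log K + (K : ℝ)⁻¹ * ∑ k, Real.exp (q ‖ν i k n ω‖)) μ :=
      (integrable_const _).add (hS i n)
    simp only [hDdef]
    rw [integral_add (integrable_const a) (hL.const_mul b),
      integral_const_mul, integral_add (integrable_const _) (hS i n), integral_const_mul,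
      integral_finsetSum _ fun k _ => hint i k n]
    simp [hval, hK]
  have hle : ∀ ω, rate S tx x ν ω ≤ ∑ i, ∑ n, D i n ω := fun ω => by
    refine maxSumRate_le S.Pcon_pos.le (fun _ _ _ => snr_nonneg _ _ _ _) fun i k n => ?_
    refine (log_one_add_snr_le _ _ _ _).trans ((hab _ (norm_nonneg _)).trans ?_)
    have := le_log_card_add_average_exp (fun k => q ‖ν i k n ω‖) k
    rw [Fintype.card_fin] at this
    simp only [hDdef]
    gcongr
  have h0 : ∀ ω, 0 ≤ rate S tx x ν ω := fun ω =>
    maxSumRate_nonneg fun _ _ _ => snr_nonneg _ _ _ _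
  have hsum : Integrable (fun ω => ∑ i, ∑ n, D i n ω) μ :=
    integrable_finsetSum _ fun i _ => integrable_finsetSum _ fun n _ => hD i n
  have hrate : Integrable (rate S tx x ν) μ :=
    hsum.mono' h.measurable_rate.aestronglyMeasurable (Eventually.of_forall fun ω => by
      rw [Real.norm_of_nonneg (h0 ω)]; exact hle ω)
  refine ⟨hrate, (integral_mono hrate hsum hle).trans_eq ?_⟩
  rw [integral_finsetSum _ fun i _ => integrable_finsetSum _ fun n _ => hD i n]
  simp_rw [integral_finsetSum _ fun n _ => hD _ n, hDval]
  simp only [Finset.sum_const, Finset.card_univ, Fintype.card_fin, nsmul_eq_mul, mul_assoc]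

lemma IsModel.ae_user_mem [IsProbabilityMeasure μ] (h : IsModel S F μ tx x ν) :
    ∀ᵐ ω ∂μ, ∀ k, x k ω ∈ Metric.closedBall (0 : Plane) S.p := by
  refine ae_all_iff.2 fun k => ?_
  have hu : μ.map (x k) = cond volume (Metric.closedBall (0 : Plane) S.p) := h.uniform_user k
  refine ae_of_ae_map (p := fun y => y ∈ Metric.closedBall (0 : Plane) S.p)
    (h.measurable_user k).aemeasurable ?_
  rw [hu]
  exact ae_cond_mem Metric.isClosed_closedBall.measurableSet

/-- With n variables, all of them stay below `s` with probability at most (1 - 1/n)^n ≤ 1/e ≤ 1/2.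
-/
lemma one_half_le_measureReal_exists_le [IsProbabilityMeasure μ] {ι : Type*} [Fintype ι]
    {Y : ι → Ω → ℝ} (hY : ∀ k, Measurable (Y k)) (hind : iIndepFun Y μ) {s : ℝ}
    (hs : ∀ k, (Fintype.card ι : ℝ)⁻¹ ≤ μ.real {ω | s ≤ Y k ω}) [Nonempty ι] :
    1 / 2 ≤ μ.real {ω | ∃ k, s ≤ Y k ω} := by
  have hc : (0 : ℝ) < Fintype.card ι := by exact_mod_cast Fintype.card_pos
  have hmeas : ∀ k, MeasurableSet {ω | s ≤ Y k ω} := fun k => measurableSet_le measurable_const (hY k)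
  have hcompl : {ω | ∃ k, s ≤ Y k ω}ᶜ = ⋂ k, Y k ⁻¹' Set.Iio s := by
    ext ω; simp
  have hprod : μ.real (⋂ k, Y k ⁻¹' Set.Iio s) = ∏ k, μ.real (Y k ⁻¹' Set.Iio s) := by
    simp only [measureReal_def]
    rw [hind.meas_iInter fun k => ⟨Set.Iio s, measurableSet_Iio, rfl⟩, ENNReal.toReal_prod]
  have hfac : ∀ k, μ.real (Y k ⁻¹' Set.Iio s) ≤ Real.exp (-(Fintype.card ι : ℝ)⁻¹) := fun k => by
    have : Y k ⁻¹' Set.Iio s = {ω | s ≤ Y k ω}ᶜ := by ext ω; simp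
    rw [this, probReal_compl_eq_one_sub (hmeas k)]
    have := Real.add_one_le_exp (-(Fintype.card ι : ℝ)⁻¹)
    linarith [hs k]
  have hle : μ.real (⋂ k, Y k ⁻¹' Set.Iio s) ≤ Real.exp (-1) := by
    rw [hprod]
    refine (Finset.prod_le_prod (fun _ _ => measureReal_nonneg) fun k _ => hfac k).trans_eq ?_
    rw [Finset.prod_const, Finset.card_univ, ← Real.exp_nat_mul]
    congr 1
    field_simp
  have hm : MeasurableSet {ω | ∃ k, s ≤ Y k ω} := by
    rw [Set.ofPred_exists]
    exact MeasurableSet.iUnion hmeas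
  have h1 := probReal_compl_eq_one_sub (μ := μ) hm
  rw [hcompl] at h1
  have h2 : Real.exp (-1) ≤ 1 / 2 := by
    rw [Real.exp_neg, one_div]
    exact inv_anti₀ two_pos (by linarith [Real.add_one_le_exp (1 : ℝ)])
  linarith

lemma IsModel.le_integral_rate [IsProbabilityMeasure μ] [NeZero K]
    (h : IsModel S F μ tx x ν) (hint : Integrable (rate S tx x ν) μ) {s : ℝ} (hs : 0 ≤ s)
    (hF : ENNReal.ofReal (K : ℝ)⁻¹ ≤ F (Set.Ici s)) :
    min (B : ℝ) N * (Real.log (1 + linkFactor S (2 * S.p) * s ^ 2) / 2) ≤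
      ∫ ω, rate S tx x ν ω ∂μ := by
  set v := Real.log (1 + linkFactor S (2 * S.p) * s ^ 2) with hv
  have hp : 0 < 2 * S.p := by linarith [S.r₀_pos, S.r₀_lt_R, S.R_lt_p]
  have hv0 : 0 ≤ v := Real.log_nonneg
    (le_add_of_nonneg_right (mul_nonneg (linkFactor_pos S hp).le (sq_nonneg s)))
  let E : Fin (min B N) → Set Ω := fun l =>
    {ω | ∃ k, s ≤ ‖ν (l.castLE (min_le_left B N)) k (l.castLE (min_le_right B N)) ω‖}
  have hEm : ∀ l, MeasurableSet (E l) := fun l => by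
    simp only [E, Set.ofPred_exists]
    exact MeasurableSet.iUnion fun k =>
      measurableSet_le measurable_const (h.measurable_fading _ k _).norm
  have hE : ∀ l, 1 / 2 ≤ μ.real (E l) := fun l => by
    refine one_half_le_measureReal_exists_le (fun k => (h.measurable_fading _ k _).norm) ?_ fun k => ?_
    · refine ((h.indep_fading.precomp
        (g := fun k => (l.castLE (min_le_left B N), k, l.castLE (min_le_right B N))) ?_).comp
        (fun _ z => ‖z‖) fun _ => measurable_norm)
      intro k k' hk
      simpa using hk
    · rw [← h.law_fading (l.castLE (min_le_left B N)) k (l.castLE (min_le_right B N)),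
        Measure.map_apply (h.measurable_fading _ k _).norm measurableSet_Ici] at hF
      rw [Fintype.card_fin]
      exact (ENNReal.ofReal_le_iff_le_toReal (measure_ne_top _ _)).1 hF
  have hle : ∀ᵐ ω ∂μ, ∑ l, (E l).indicator (fun _ => v) ω ≤ rate S tx x ν ω := by
    filter_upwards [h.ae_user_mem] with ω hω
    refine sum_le_maxSumRate S.Pcon_pos.le (fun _ _ _ => snr_nonneg _ _ _ _) fun l => ?_
    by_cases hl : ω ∈ E l
    · obtain ⟨k, hk⟩ := hl
      refine ⟨k, ?_⟩
      rw [Set.indicator_of_mem (show ω ∈ E l from ⟨k, hk⟩)]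
      exact le_log_one_add_snr S _ (h.tx_mem _) (hω k) hs hk
    · refine ⟨0, ?_⟩
      rw [Set.indicator_of_notMem hl]
      exact Real.log_nonneg
        (le_add_of_nonneg_right (mul_nonneg S.Pcon_pos.le (snr_nonneg _ _ _ _)))
  have hi : ∀ l, Integrable ((E l).indicator fun _ => v) μ := fun l =>
    (integrable_const v).indicator (hEm l)
  refine le_trans ?_ (integral_mono_ae (integrable_finsetSum _ fun l _ => hi l) hint hle)
  rw [integral_finsetSum _ fun l _ => hi l]
  simp_rw [integral_indicator_const v (hEm _), smul_eq_mul]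
  calc min (B : ℝ) N * (v / 2) = ∑ _l : Fin (min B N), 1 / 2 * v := by
        rw [Finset.sum_const, Finset.card_univ, Fintype.card_fin, nsmul_eq_mul, Nat.cast_min]
        ring
    _ ≤ _ := Finset.sum_le_sum fun l _ => mul_le_mul_of_nonneg_right (hE l) hv0

end Expectation

/-- Criterion for a scaling law: an exponential moment of `q` controls the rate from above, and a
sequence of levels exceeded with probability at least `1 / K` controls it from below. -/
lemma scalingLaw_of_bounds (S : Params) {F : Measure ℝ} {g : ℕ → ℝ} {q : ℝ → ℝ}
    (hq : Integrable (fun y => Real.exp (q y)) F)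
    (hupper : ∀ c M : ℝ, 0 < c → ∃ C, 0 < C ∧ ∀ᶠ K : ℕ in atTop, ∃ a b : ℝ, 0 ≤ b ∧
      (∀ y, 0 ≤ y → Real.log (1 + c * y ^ 2) ≤ a + b * q y) ∧
      a + b * (Real.log K + M) ≤ C * g K)
    (s : ℕ → ℝ) (hs : ∀ᶠ K in atTop, 0 ≤ s K)
    (htail : ∀ᶠ K : ℕ in atTop, ENNReal.ofReal (K : ℝ)⁻¹ ≤ F (Set.Ici (s K)))
    (hlower : ∀ c : ℝ, 0 < c → ∃ d, 0 < d ∧ ∀ᶠ K in atTop,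
      d * g K ≤ Real.log (1 + c * s K ^ 2)) :
    ScalingLaw.{u} S F g := by
  have hp : 0 < 2 * S.p := by linarith [S.r₀_pos, S.r₀_lt_R, S.R_lt_p]
  obtain ⟨C, hC, hu⟩ := hupper (linkFactor S S.r₀) (∫ y, Real.exp (q y) ∂F)
    (linkFactor_pos S S.r₀_pos)
  obtain ⟨d, hd, hl⟩ := hlower (linkFactor S (2 * S.p)) (linkFactor_pos S hp)
  obtain ⟨K₀, hK₀⟩ := eventually_atTop.1
    (hu.and (hl.and (hs.and (htail.and (eventually_ge_atTop 1)))))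
  refine ⟨C, hC, d / 2, by positivity, K₀, fun K B N hK _ _ Ω _ μ _ tx x ν h => ?_⟩
  obtain ⟨⟨a, b, hb, hab, hle⟩, hlow, hs0, hF, hK1⟩ := hK₀ K hK
  have : NeZero K := ⟨by omega⟩
  obtain ⟨hint, hup⟩ := h.integrable_rate_and_integral_le hq hb hab
  refine ⟨hint, hup.trans ?_, le_trans ?_ (h.le_integral_rate hint hs0 hF)⟩
  · calc (B : ℝ) * N * (a + b * (Real.log K + ∫ y, Real.exp (q y) ∂F))
        ≤ B * N * (C * g K) := by gcongr
      _ = C * (B * N * g K) := by ring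
  · calc d / 2 * (min (B : ℝ) N * g K) = min (B : ℝ) N * (d * g K / 2) := by ring
      _ ≤ _ := by gcongr


/-! ### Elementary logarithmic estimates and tails of densities -/

lemma tendsto_log_natCast_atTop : Tendsto (fun K : ℕ => Real.log K) atTop atTop :=
  Real.tendsto_log_atTop.comp tendsto_natCast_atTop_atTop

lemma log_one_add_mul_sq_le {c y : ℝ} (hc : 0 < c) (hy : 1 ≤ y) :
    Real.log (1 + c * y ^ 2) ≤ Real.log (1 + c) + 2 * Real.log y := by
  have hy0 : 0 < y := by linarith
  calc Real.log (1 + c * y ^ 2) ≤ Real.log ((1 + c) * y ^ 2) :=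
        Real.log_le_log (by positivity) (by nlinarith)
    _ = _ := by
        rw [Real.log_mul (by positivity) (by positivity), Real.log_pow]
        norm_num

lemma log_one_add_mul_sq_le_of_le_one {c y : ℝ} (hc : 0 < c) (hy : 0 ≤ y) (hy1 : y ≤ 1) :
    Real.log (1 + c * y ^ 2) ≤ Real.log (1 + c) :=
  Real.log_le_log (by positivity) (by nlinarith [pow_le_one₀ (n := 2) hy hy1])

lemma log_add_two_mul_log_le {c y : ℝ} (hc : 0 < c) (hy : 0 < y) :
    Real.log c + 2 * Real.log y ≤ Real.log (1 + c * y ^ 2) := by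
  calc Real.log c + 2 * Real.log y = Real.log (c * y ^ 2) := by
        rw [Real.log_mul hc.ne' (by positivity), Real.log_pow]
        norm_num
    _ ≤ _ := Real.log_le_log (by positivity) (by linarith)

/-- A density bounded below by a stretched exponential exceeds the level `(δ log K) ^ (1 / t)` with
probability at least `1 / K`. -/
lemma exists_eventually_inv_le_withDensity_Ici {f : ℝ → ℝ} {C b t : ℝ} (hC : 0 < C) (hb : 0 < b)
    (ht : 0 < t) (hf : ∀ x, 1 ≤ x → C * Real.exp (-b * x ^ t) ≤ f x) :
    ∃ δ, 0 < δ ∧ ∀ᶠ K : ℕ in atTop, ENNReal.ofReal (K : ℝ)⁻¹ ≤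
      (volume.withDensity fun x => ENNReal.ofReal (f x))
        (Set.Ici ((δ * Real.log K) ^ (1 / t))) := by
  have h2 : (0 : ℝ) < 2 ^ t := by positivity
  -- On `[s, s + 1]`, where `x ≤ 2 * s`, this choice gives `b * x ^ t ≤ L / 2`; the other half of
  -- `L` absorbs `log C`.
  set δ : ℝ := (2 * b * 2 ^ t)⁻¹ with hδ
  have hδ0 : 0 < δ := by positivity
  refine ⟨δ, hδ0, ?_⟩
  filter_upwards [tendsto_log_natCast_atTop.eventually_ge_atTop δ⁻¹,
    tendsto_log_natCast_atTop.eventually_ge_atTop (-2 * Real.log C), eventually_ge_atTop 1]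
    with K hK1 hK2 hK0
  set L := Real.log K with hL
  have hKpos : (0 : ℝ) < K := by exact_mod_cast hK0
  have hδL : 1 ≤ δ * L := by
    calc 1 = δ * δ⁻¹ := (mul_inv_cancel₀ hδ0.ne').symm
      _ ≤ δ * L := by gcongr
  set s := (δ * L) ^ (1 / t) with hs
  have hs1 : 1 ≤ s := Real.one_le_rpow hδL (by positivity)
  have hst : s ^ t = δ * L := by
    rw [hs, ← Real.rpow_mul (by linarith), one_div_mul_cancel ht.ne', Real.rpow_one]
  have hlow : ∀ x ∈ Set.Icc s (s + 1), (K : ℝ)⁻¹ ≤ f x := fun x hx => by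
    have hx1 : 1 ≤ x := hs1.trans hx.1
    refine le_trans ?_ (hf x hx1)
    have hxt : x ^ t ≤ 2 ^ t * (δ * L) := by
      rw [← hst, ← Real.mul_rpow zero_le_two (by linarith)]
      exact Real.rpow_le_rpow (by linarith) (by linarith [hx.2]) ht.le
    have hbx : b * x ^ t ≤ L / 2 := by
      calc b * x ^ t ≤ b * (2 ^ t * (δ * L)) := by gcongr
        _ = L / 2 := by rw [hδ]; field_simp
    calc (K : ℝ)⁻¹ = Real.exp (-L) := by rw [Real.exp_neg, hL, Real.exp_log hKpos]
      _ ≤ Real.exp (Real.log C + -b * x ^ t) := Real.exp_le_exp.2 (by linarith)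
      _ = C * Real.exp (-b * x ^ t) := by rw [Real.exp_add, Real.exp_log hC]
  -- The interval has length 1, so the pointwise bound on the density is already the bound on the
  -- mass.
  calc ENNReal.ofReal (K : ℝ)⁻¹ = ∫⁻ _ in Set.Icc s (s + 1), ENNReal.ofReal (K : ℝ)⁻¹ := by
        simp
    _ ≤ ∫⁻ x in Set.Icc s (s + 1), ENNReal.ofReal (f x) :=
        setLIntegral_mono' measurableSet_Icc fun x hx => ENNReal.ofReal_le_ofReal (hlow x hx)
    _ ≤ ∫⁻ x in Set.Ici s, ENNReal.ofReal (f x) := lintegral_mono_set Set.Icc_subset_Ici_self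
    _ = _ := (withDensity_apply _ measurableSet_Ici).symm

/-! ### Generalized gamma laws -/

/-- The unnormalized density of a generalized gamma law. -/
noncomputable def generalizedGammaPDF (c q b t x : ℝ) : ℝ :=
  if 0 < x then c * x ^ q * Real.exp (-b * x ^ t) else 0

lemma measurable_generalizedGammaPDF (c q b t : ℝ) : Measurable (generalizedGammaPDF c q b t) := by
  unfold generalizedGammaPDF
  exact Measurable.ite measurableSet_Ioi (by fun_prop) measurable_const

/-- The moment uses up half of the decay rate `b`; the other half keeps the integral finite at
infinity, and `-1 < q` does so at 0. -/
lemma integrable_exp_withDensity_generalizedGammaPDF {c q b t : ℝ} (hc : 0 < c) (hq : -1 < q)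
    (hb : 0 < b) (ht : 0 < t) :
    Integrable (fun y => Real.exp (b / 2 * y ^ t))
      (volume.withDensity fun x => ENNReal.ofReal (generalizedGammaPDF c q b t x)) := by
  rw [integrable_withDensity_iff_integrable_smul'
    (measurable_generalizedGammaPDF c q b t).ennreal_ofReal (by simp)]
  have h := (integrableOn_rpow_mul_exp_neg_mul_rpow hq ht (half_pos hb)).const_mul c
  refine ((integrable_indicator_iff measurableSet_Ioi).2 h).congr (Eventually.of_forall fun x => ?_)
  by_cases hx : 0 < x
  · have hpos : 0 ≤ c * x ^ q * Real.exp (-b * x ^ t) := by positivity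
    simp only [Set.indicator_of_mem (Set.mem_Ioi.2 hx), generalizedGammaPDF, if_pos hx,
      ENNReal.toReal_ofReal hpos, smul_eq_mul]
    rw [mul_assoc, mul_assoc, ← Real.exp_add]
    congr 3
    ring
  · simp [generalizedGammaPDF, hx]

/-- The factor `x ^ q` may decay, but for `x ≥ 1` it is at least `x⁻¹`, and `log x ≤ x ^ t / t`
trades this for a slightly larger rate. -/
lemma exp_neg_le_generalizedGammaPDF {c q b t x : ℝ} (hc : 0 < c) (hq : -1 < q) (ht : 0 < t)
    (hx : 1 ≤ x) : c * Real.exp (-(b + 1 / t) * x ^ t) ≤ generalizedGammaPDF c q b t x := by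
  have hx0 : 0 < x := by linarith
  rw [generalizedGammaPDF, if_pos hx0, mul_assoc]
  refine mul_le_mul_of_nonneg_left ?_ hc.le
  have hlog : -(1 / t * x ^ t) ≤ Real.log x * q := by
    have h1 : Real.log x ≤ 1 / t * x ^ t := by
      have := Real.log_le_sub_one_of_pos (Real.rpow_pos_of_pos hx0 t)
      rw [Real.log_rpow hx0] at this
      calc Real.log x = 1 / t * (t * Real.log x) := by field_simp
        _ ≤ 1 / t * x ^ t := by gcongr; linarith
    nlinarith [Real.log_nonneg hx]
  rw [Real.rpow_def_of_pos hx0 q, ← Real.exp_add]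
  exact Real.exp_le_exp.2 (by linarith)

lemma log_one_add_mul_sq_le_log_one_add_rpow {c t y : ℝ} (hc : 0 < c) (ht : 0 < t) (hy : 0 ≤ y) :
    Real.log (1 + c * y ^ 2) ≤ Real.log (1 + c) + 2 / t * Real.log (1 + y ^ t) := by
  have hyt : 0 ≤ y ^ t := Real.rpow_nonneg hy t
  rcases le_total y 1 with h | h
  · have : 0 ≤ 2 / t * Real.log (1 + y ^ t) :=
      mul_nonneg (by positivity) (Real.log_nonneg (by linarith))
    linarith [log_one_add_mul_sq_le_of_le_one hc hy h]
  · have hy0 : 0 < y := by linarith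
    have h1 : Real.log (y ^ t) ≤ Real.log (1 + y ^ t) :=
      Real.log_le_log (Real.rpow_pos_of_pos hy0 t) (by linarith)
    rw [Real.log_rpow hy0] at h1
    have h2 : 2 * Real.log y ≤ 2 / t * Real.log (1 + y ^ t) := by
      calc 2 * Real.log y = 2 / t * (t * Real.log y) := by field_simp
        _ ≤ _ := by gcongr
    linarith [log_one_add_mul_sq_le hc h]

lemma scalingLaw_generalizedGamma (S : Params) {c q b t : ℝ} (hc : 0 < c) (hq : -1 < q)
    (hb : 0 < b) (ht : 0 < t) :
    ScalingLaw.{u} S (volume.withDensity fun x => ENNReal.ofReal (generalizedGammaPDF c q b t x))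
      fun K => Real.log (Real.log K) := by
  have hll : Tendsto (fun K : ℕ => Real.log (Real.log K)) atTop atTop :=
    Real.tendsto_log_atTop.comp tendsto_log_natCast_atTop
  obtain ⟨δ, hδ, htail⟩ := exists_eventually_inv_le_withDensity_Ici
    (f := generalizedGammaPDF c q b t) hc (by positivity : 0 < b + 1 / t) ht
    fun x hx => exp_neg_le_generalizedGammaPDF hc hq ht hx
  refine scalingLaw_of_bounds S (integrable_exp_withDensity_generalizedGammaPDF hc hq hb ht)
    (fun c' M hc' => ⟨2 / t + 1, by positivity, ?_⟩) _ ?_ htail fun c' hc' => ⟨1 / t, by positivity, ?_⟩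
  · set θ := b / 2 with hθ
    have hθ0 : 0 < θ := half_pos hb
    filter_upwards [tendsto_log_natCast_atTop.eventually_ge_atTop 1,
      hll.eventually_ge_atTop (Real.log (1 + c') + 2 / t * (1 + (1 + |M|) / θ))] with K hK1 hK2
    set A := Real.log K with hA
    have hA0 : 0 < A := by linarith
    -- The line comes from the tangent bound log z ≤ log A + z/A - 1 at z = 1 + y^t, with the -1
    -- dropped. At A = log K its slope cancels the growth of `log K`, leaving (2/t) log A plus
    -- bounded terms, which one more log A absorbs.
    refine ⟨Real.log (1 + c') + 2 / t * (Real.log A + 1 / A), 2 / t * (1 / (A * θ)),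
      by positivity, fun y hy => ?_, ?_⟩
    · have hyt : 0 ≤ y ^ t := Real.rpow_nonneg hy t
      have h1 : Real.log (1 + y ^ t) ≤ Real.log A + 1 / A + 1 / (A * θ) * (θ * y ^ t) := by
        have h2 := Real.log_le_sub_one_of_pos (show 0 < (1 + y ^ t) / A by positivity)
        rw [Real.log_div (by positivity) hA0.ne'] at h2
        have h3 : (1 + y ^ t) / A = 1 / A + 1 / (A * θ) * (θ * y ^ t) := by field_simp
        linarith
      have h4 := mul_le_mul_of_nonneg_left h1 (show 0 ≤ 2 / t by positivity)
      linarith [log_one_add_mul_sq_le_log_one_add_rpow hc' ht hy]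
    · have h1 : 1 / A + 1 / (A * θ) * (A + M) ≤ 1 + (1 + |M|) / θ := by
        have h2 : 1 / A ≤ 1 := by rw [div_le_one hA0]; exact hK1
        have h3 : 1 / (A * θ) * (A + M) ≤ (1 + |M|) / θ := by
          rw [one_div_mul_eq_div, div_le_div_iff₀ (by positivity) hθ0]
          have : A + M ≤ (1 + |M|) * A := by nlinarith [le_abs_self M, abs_nonneg M]
          nlinarith
        linarith
      have h4 := mul_le_mul_of_nonneg_left h1 (show 0 ≤ 2 / t by positivity)
      linarith
  · filter_upwards [tendsto_log_natCast_atTop.eventually_ge_atTop 0] with K hK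
    exact Real.rpow_nonneg (mul_nonneg hδ.le hK) _
  -- The true coefficient is `2 / t`; half of it is given up to absorb `log c'` and `log δ`.
  · filter_upwards [tendsto_log_natCast_atTop.eventually_gt_atTop 0,
      (hll.const_mul_atTop (show 0 < 1 / t by positivity)).eventually_ge_atTop
        (-(Real.log c' + 2 / t * Real.log δ))] with K hK1 hK2
    have hpos : 0 < δ * Real.log K := mul_pos hδ hK1
    refine le_trans ?_ (log_add_two_mul_log_le hc' (Real.rpow_pos_of_pos hpos _))
    rw [Real.log_rpow hpos, Real.log_mul hδ.ne' hK1.ne']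
    have : 2 * (1 / t * (Real.log δ + Real.log (Real.log K))) =
      2 / t * Real.log δ + 1 / t * Real.log (Real.log K) + 1 / t * Real.log (Real.log K) := by ring
    linarith

lemma ScalingLaw.const_mul {S : Params} {F : Measure ℝ} {g : ℕ → ℝ} (h : ScalingLaw.{u} S F g)
    {κ : ℝ} (hκ : 0 < κ) : ScalingLaw.{u} S F fun K => κ * g K := by
  obtain ⟨c₁, h₁, c₂, h₂, K₀, H⟩ := h
  refine ⟨c₁ / κ, by positivity, c₂ / κ, by positivity, K₀,
    fun K B N hK hB hN Ω _ μ _ tx x ν hm => ?_⟩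
  obtain ⟨hi, hu, hl⟩ := H K B N hK hB hN Ω μ tx x ν hm
  refine ⟨hi, hu.trans_eq ?_, le_trans (le_of_eq ?_) hl⟩ <;> field_simp

lemma nakagamiPDF_eq (m w : ℝ) : nakagamiPDF m w =
    generalizedGammaPDF (2 * m ^ m / (Real.Gamma m * w ^ m)) (2 * m - 1) (m / w) 2 := by
  ext x
  simp only [nakagamiPDF, generalizedGammaPDF, Real.rpow_two]

lemma weibullPDF_eq {l t : ℝ} (hl : 0 < l) : weibullPDF l t =
    generalizedGammaPDF (t / l * (l ^ (t - 1))⁻¹) (t - 1) (l ^ t)⁻¹ t := by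
  ext x
  unfold weibullPDF generalizedGammaPDF
  refine if_ctx_congr Iff.rfl (fun hx => ?_) fun _ => rfl
  rw [Real.div_rpow hx.le hl.le, Real.div_rpow hx.le hl.le]
  have hexp : -(x ^ t / l ^ t) = -(l ^ t)⁻¹ * x ^ t := by ring
  rw [hexp]
  ring

/-! ### The log-normal law -/

lemma log_one_add_mul_sq_le_abs_log {c y : ℝ} (hc : 0 < c) (hy : 0 ≤ y) :
    Real.log (1 + c * y ^ 2) ≤ Real.log (1 + c) + 2 * |Real.log y| := by
  rcases le_total y 1 with h | h
  · linarith [log_one_add_mul_sq_le_of_le_one hc hy h, abs_nonneg (Real.log y)]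
  · linarith [log_one_add_mul_sq_le hc h, le_abs_self (Real.log y)]

/-- Fernique's theorem for the underlying Gaussian, transported by `exp`. -/
lemma exists_integrable_exp_sq_log_logNormal (a : ℝ) (v : ℝ≥0) :
    ∃ θ, 0 < θ ∧ Integrable (fun y => Real.exp (θ * Real.log y ^ 2)) (logNormal a v) := by
  obtain ⟨θ, hθ, hi⟩ := IsGaussian.exists_integrable_exp_sq (gaussianReal a v)
  refine ⟨θ, hθ, ?_⟩
  rw [logNormal, integrable_map_measure (by fun_prop) (by fun_prop)]
  simpa [Function.comp_def] using hi

/-- For `x ≥ 1` the shift is absorbed by `|x - a| ≤ (1 + |a|) * x`, which gives the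
stretched-exponential form with exponent 2. -/
lemma exp_neg_le_gaussianPDFReal (a : ℝ) {v : ℝ≥0} (hv : 0 < v) {x : ℝ} (hx : 1 ≤ x) :
    (√(2 * Real.pi * v))⁻¹ * Real.exp (-((1 + |a|) ^ 2 / (2 * v)) * x ^ (2 : ℝ)) ≤
      gaussianPDFReal a v x := by
  have hv' : (0 : ℝ) < v := hv
  rw [gaussianPDFReal, Real.rpow_two]
  gcongr
  rw [neg_mul, neg_div, neg_le_neg_iff, div_mul_eq_mul_div, ← mul_pow]
  have h : |x - a| ≤ (1 + |a|) * x := by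
    have := abs_sub x a
    rw [abs_of_nonneg (by linarith : 0 ≤ x)] at this
    nlinarith [abs_nonneg a]
  gcongr ?_ / _
  rw [← sq_abs (x - a)]
  gcongr

lemma scalingLaw_logNormal (S : Params) (a : ℝ) {v : ℝ≥0} (hv : 0 < v) :
    ScalingLaw.{u} S (logNormal a v) fun K => √(Real.log K) := by
  have hv' : (0 : ℝ) < v := hv
  have hsq : Tendsto (fun K : ℕ => √(Real.log K)) atTop atTop :=
    Real.tendsto_sqrt_atTop.comp tendsto_log_natCast_atTop
  obtain ⟨θ, hθ, hint⟩ := exists_integrable_exp_sq_log_logNormal a v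
  obtain ⟨δ, hδ, htail⟩ := exists_eventually_inv_le_withDensity_Ici
    (f := gaussianPDFReal a v) (by positivity) (by positivity) two_pos
    fun x hx => exp_neg_le_gaussianPDFReal a hv hx
  refine scalingLaw_of_bounds S hint (fun c M hc => ⟨2 + 1 / θ, by positivity, ?_⟩)
    (fun K => Real.exp (√δ * √(Real.log K))) (Eventually.of_forall fun K => (Real.exp_pos _).le) ?_
    fun c hc => ⟨√δ, by positivity, ?_⟩
  · filter_upwards [hsq.eventually_ge_atTop 1,
      hsq.eventually_ge_atTop (Real.log (1 + c) + |M| / θ),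
      tendsto_log_natCast_atTop.eventually_ge_atTop 0] with K hK1 hK2 hK0
    have hAA := Real.mul_self_sqrt hK0
    set A := √(Real.log K) with hA
    have hA0 : 0 < A := by linarith
    -- From 2|u| ≤ A + u²/A with u = log y and A = √(log K). The total is A + A/θ plus bounded
    -- terms, which one more A absorbs; hence `2 + 1 / θ`.
    refine ⟨Real.log (1 + c) + A, 1 / (A * θ), by positivity, fun y hy => ?_, ?_⟩
    · have h1 : 2 * |Real.log y| ≤ A + 1 / (A * θ) * (θ * Real.log y ^ 2) := by
        have h2 : A + 1 / (A * θ) * (θ * Real.log y ^ 2) - 2 * |Real.log y| =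
            (A - |Real.log y|) ^ 2 / A := by
          rw [← sq_abs (Real.log y)]
          field_simp
          ring
        have h3 : 0 ≤ (A - |Real.log y|) ^ 2 / A := by positivity
        linarith
      linarith [log_one_add_mul_sq_le_abs_log hc hy]
    · rw [← hAA]
      have h1 : 1 / (A * θ) * (A * A + M) = 1 / θ * A + M / θ / A := by field_simp
      have h2 : M / θ / A ≤ |M| / θ := by
        rw [div_le_iff₀ hA0]
        have h3 : M / θ ≤ |M| / θ := by gcongr; exact le_abs_self M
        nlinarith [show 0 ≤ |M| / θ by positivity]
      rw [h1]
      linarith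
  · filter_upwards [htail] with K hK
    rw [logNormal, Measure.map_apply Real.measurable_exp measurableSet_Ici,
      gaussianReal_of_var_ne_zero _ hv.ne', gaussianPDF_def]
    refine hK.trans (measure_mono fun x hx => ?_)
    rw [← Real.sqrt_eq_rpow, Real.sqrt_mul hδ.le] at hx
    exact Real.exp_le_exp.2 hx
  -- Of the two copies of `√δ * √(log K)` in `2 * log s`, one absorbs `log c`.
  · filter_upwards [(hsq.const_mul_atTop (Real.sqrt_pos.2 hδ)).eventually_ge_atTop (-Real.log c)]
      with K hK
    have := log_add_two_mul_log_le hc (Real.exp_pos (√δ * √(Real.log K)))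
    rw [Real.log_exp] at this
    linarith

end DenseNetwork

theorem lemma2 (S : DenseNetwork.Params) :
    (∀ m w : ℝ, 0 < m → 0 < w →
      DenseNetwork.ScalingLaw.{u} S (DenseNetwork.nakagami m w)
        (fun K => Real.log (Real.log (K : ℝ)))) ∧
    (∀ l t : ℝ, 0 < l → 0 < t →
      DenseNetwork.ScalingLaw.{u} S (DenseNetwork.weibull l t)
        (fun K => Real.log (Real.log (K : ℝ) ^ (2 / t)))) ∧
    (∀ (a : ℝ) (v : NNReal), 0 < v →
      DenseNetwork.ScalingLaw.{u} S (DenseNetwork.logNormal a v)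
        (fun K => Real.sqrt (Real.log (K : ℝ)))) := by
  refine ⟨fun m w hm hw => ?_, fun l t hl ht => ?_,
    fun a v hv => DenseNetwork.scalingLaw_logNormal S a hv⟩
  · rw [DenseNetwork.nakagami, DenseNetwork.nakagamiPDF_eq]
    have := Real.Gamma_pos_of_pos hm
    exact DenseNetwork.scalingLaw_generalizedGamma S (by positivity) (by linarith) (by positivity)
      two_pos
  · have hg : (fun K : ℕ => Real.log (Real.log (K : ℝ) ^ (2 / t))) =
        fun K : ℕ => 2 / t * Real.log (Real.log (K : ℝ)) := by
      funext K
      -- When `log K = 0`, both sides vanish by the convention `log 0 = 0`.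
      rcases (Real.log_natCast_nonneg K).eq_or_lt with h | h
      · rw [← h, Real.zero_rpow (by positivity), Real.log_zero, mul_zero]
      · exact Real.log_rpow h _
    rw [hg, DenseNetwork.weibull, DenseNetwork.weibullPDF_eq hl]
    exact (DenseNetwork.scalingLaw_generalizedGamma S (by positivity) (by linarith)
      (by positivity) ht).const_mul (by positivity)
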